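/- Let $d\ge 0$ be an integer, let $K_0,\dots,K_d$ be groups such that, for each $i$, the only homomorphism from $K_i$ to the additive group $\mathbb{R}$ is the trivial one, and let $X$ be a complete $\mathrm{CAT}(0)$ space that contains no $(d+1)$-flat, i.e. there is no isometric embedding $\mathbb{E}^{d+1}\hookrightarrow X$ of Euclidean $(d+1)$-space. Then there is no action by isometries, i.e. no homomorphism $\rho: K_0\times\dots\times K_d\to\mathrm{Isom}(X)$, such that for every $i\in\{0,\dots,d\}$ the image $\rho(K_i)$ of the $i$-th factor contains a hyperbolic isometry. Here an isometry $\gamma$ of $X$ is called hyperbolic if $|\gamma|:=\inf\{d(x,\gamma x) : x\in X\}$ is positive and is attained at some point of $X$. -/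

import Mathlib

/-- `c` restricted to `[0, dist x y]` is a (unit speed) geodesic from `x` to `y`. -/
def IsGeodesicFromTo {X : Type*} [MetricSpace X] (c : ℝ → X) (x y : X) : Prop :=
  c 0 = x ∧ c (dist x y) = y ∧
    ∀ s ∈ Set.Icc (0 : ℝ) (dist x y), ∀ t ∈ Set.Icc (0 : ℝ) (dist x y),
      dist (c s) (c t) = |s - t|

/-- `X` is a geodesic space: any two points are joined by a geodesic. -/
def IsGeodesicSpace (X : Type*) [MetricSpace X] : Prop :=
  ∀ x y : X, ∃ c : ℝ → X, IsGeodesicFromTo c x y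

/-- `X` is a CAT(0) space: a geodesic space in which every geodesic triangle is at least as thin as
its comparison triangle `(x', y', z')` in the Euclidean plane. Two points of a geodesic triangle
lying on different sides lie on two sides that issue from a common vertex, called `x` here
(for points on the same side the comparison inequality is an equality). The points `p'`, `q'` are
the comparison points of `c s` and `e t`. -/
def IsCAT0 (X : Type*) [MetricSpace X] : Prop :=
  IsGeodesicSpace X ∧
    ∀ (x y z : X) (c e : ℝ → X), IsGeodesicFromTo c x y → IsGeodesicFromTo e x z →
      ∀ x' y' z' : EuclideanSpace ℝ (Fin 2),
        dist x' y' = dist x y → dist x' z' = dist x z → dist y' z' = dist y z →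
        ∀ s ∈ Set.Icc (0 : ℝ) (dist x y), ∀ t ∈ Set.Icc (0 : ℝ) (dist x z),
          ∀ p' ∈ segment ℝ x' y', ∀ q' ∈ segment ℝ x' z',
            dist x' p' = s → dist x' q' = t → dist (c s) (e t) ≤ dist p' q'

/-- `X` contains an `n`-flat: an isometrically embedded copy of Euclidean `n`-space. -/
def ContainsFlat (X : Type*) [MetricSpace X] (n : ℕ) : Prop :=
  ∃ f : EuclideanSpace ℝ (Fin n) → X, Isometry f

/-- The translation length `|γ| = inf {d(x, γ x) | x ∈ X}`. -/
noncomputable def translationLength {X : Type*} [MetricSpace X] (γ : X ≃ᵢ X) : ℝ :=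
  ⨅ x : X, dist x (γ x)

/-- `Min(γ)`, the set of points at which the displacement of `γ` equals `|γ|`. -/
def minSet {X : Type*} [MetricSpace X] (γ : X ≃ᵢ X) : Set X :=
  {p | dist p (γ p) = translationLength γ}

/-- `γ` is semisimple: its displacement function attains its infimum. -/
def IsSemisimpleIsometry {X : Type*} [MetricSpace X] (γ : X ≃ᵢ X) : Prop :=
  (minSet γ).Nonempty

/-- `γ` is hyperbolic: semisimple with positive translation length. -/
def IsHyperbolicIsometry {X : Type*} [MetricSpace X] (γ : X ≃ᵢ X) : Prop :=
  IsSemisimpleIsometry γ ∧ 0 < translationLength γ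

/-! Choose a hyperbolic `γ i` in the image of each factor; these isometries commute. Nearest-point
projection yields a point common to all the sets `minSet (γ i)` (`IsCAT0.nonempty_biInter_minSet`).
Any two axes of `γ i` bound a flat strip (`IsCAT0.dist_sq_axis`), so points of `minSet (γ i)` have a
coordinate along the axis direction. Twice the coordinate difference is `axialShift`, an additive
cocycle (`IsCAT0.axialShift_add`) invariant under isometries commuting with `γ i`. For `j ≠ i` the
factor `K j` therefore translates this coordinate through a homomorphism to `ℝ`, which vanishes
(`IsCAT0.axialShift_apply_eq_zero`). Hence the axes of different `γ i` are orthogonal, and attaching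
them one direction at a time to the common point builds a `(d + 1)`-flat
(`IsCAT0.containsFlat_of_axialShift_eq_zero`). -/

/-- Every triple of side lengths satisfying the triangle inequalities is realised by a triangle
in the Euclidean plane. -/
lemma exists_comparison_triangle {X : Type*} [MetricSpace X] (x y z : X) :
    ∃ x' y' z' : EuclideanSpace ℝ (Fin 2),
      dist x' y' = dist x y ∧ dist x' z' = dist x z ∧ dist y' z' = dist y z := by
  set a := dist x y with ha
  set b := dist x z with hb
  set c := dist y z with hc
  have ha0 : 0 ≤ a := dist_nonneg
  have hb0 : 0 ≤ b := dist_nonneg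
  have hc0 : 0 ≤ c := dist_nonneg
  have h1 : a ≤ b + c := by rw [ha, hb, hc, dist_comm y z]; exact dist_triangle _ _ _
  have h2 : b ≤ a + c := dist_triangle _ _ _
  have h3 : c ≤ a + b := by rw [ha, hb, hc, dist_comm x y]; exact dist_triangle _ _ _
  rcases ha0.eq_or_lt with h0 | hpos
  · refine ⟨0, 0, !₂[b, 0], ?_, ?_, ?_⟩
    · simpa using h0
    · simp [EuclideanSpace.dist_eq, Real.sqrt_sq_eq_abs, abs_of_nonneg hb0]
    · have : b = c := by linarith
      simp [EuclideanSpace.dist_eq, this, hc0]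
  · set u := (a ^ 2 + b ^ 2 - c ^ 2) / (2 * a) with hu
    have hua : 2 * a * u = a ^ 2 + b ^ 2 - c ^ 2 := by rw [hu]; field_simp
    have hub : u ^ 2 ≤ b ^ 2 := by
      have h4 : (2 * a * u) ^ 2 ≤ (2 * a * b) ^ 2 := by
        rw [hua]
        apply sq_le_sq'
        · nlinarith [mul_nonneg (by linarith : 0 ≤ a + b - c) (by linarith : 0 ≤ a + b + c)]
        · nlinarith [mul_nonneg (by linarith : 0 ≤ c - a + b) (by linarith : 0 ≤ c + a - b)]
      have h5 : 0 < (2 * a) ^ 2 := by positivity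
      rw [mul_pow, mul_pow (2 * a)] at h4
      exact le_of_mul_le_mul_left h4 h5
    have hv : Real.sqrt (b ^ 2 - u ^ 2) ^ 2 = b ^ 2 - u ^ 2 := Real.sq_sqrt (by linarith)
    refine ⟨0, !₂[a, 0], !₂[u, Real.sqrt (b ^ 2 - u ^ 2)], ?_, ?_, ?_⟩
    · simp [EuclideanSpace.dist_eq, Real.sqrt_sq_eq_abs, abs_of_nonneg ha0]
    · rw [EuclideanSpace.dist_eq, Real.sqrt_eq_iff_mul_self_eq (by positivity) hb0]
      simp [Real.dist_eq, sq_abs, hv]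
      ring
    · rw [EuclideanSpace.dist_eq, Real.sqrt_eq_iff_mul_self_eq (by positivity) hc0]
      simp [Real.dist_eq, sq_abs, hv]
      linarith

/-- Stewart's identity in a real inner product space. -/
lemma dist_sq_lineMap {E : Type*} [NormedAddCommGroup E] [InnerProductSpace ℝ E]
    (x y z : E) (r : ℝ) :
    dist x (AffineMap.lineMap y z r) ^ 2 =
      (1 - r) * dist x y ^ 2 + r * dist x z ^ 2 - r * (1 - r) * dist y z ^ 2 := by
  have h1 : x - AffineMap.lineMap y z r = (1 - r) • (x - y) + r • (x - z) := by
    rw [AffineMap.lineMap_apply_module]; module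
  have h2 : y - z = (x - z) - (x - y) := by abel
  rw [dist_eq_norm, dist_eq_norm, dist_eq_norm, dist_eq_norm, h1, h2, norm_add_sq_real,
    norm_sub_sq_real (x - z), norm_smul, norm_smul, inner_smul_left, inner_smul_right, mul_pow,
    mul_pow, Real.norm_eq_abs, Real.norm_eq_abs, sq_abs, sq_abs, real_inner_comm (x - y) (x - z)]
  simp only [conj_trivial]
  ring

/-! ### Metric inequalities in CAT(0) spaces. -/

section CAT0

variable {X : Type*} [MetricSpace X]

/-- `w` divides the pair `(y, z)` in the ratio `r : 1 - r`. -/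
def DividesAt (r : ℝ) (y z w : X) : Prop :=
  dist y w = r * dist y z ∧ dist w z = (1 - r) * dist y z

/-- Comparison with Stewart's identity. The point `w` is chosen before `x`, so that the inequality
can later be used to prove `w` unique. -/
lemma IsCAT0.exists_dividesAt_forall_dist_sq_le (hX : IsCAT0 X) {r : ℝ} (h0 : 0 ≤ r) (h1 : r ≤ 1)
    (y z : X) : ∃ w, DividesAt r y z w ∧ ∀ x, dist x w ^ 2 ≤
      (1 - r) * dist x y ^ 2 + r * dist x z ^ 2 - r * (1 - r) * dist y z ^ 2 := by
  obtain ⟨c, hc⟩ := hX.1 y z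
  have hL : 0 ≤ dist y z := dist_nonneg
  have hs : r * dist y z ∈ Set.Icc (0 : ℝ) (dist y z) :=
    ⟨by positivity, mul_le_of_le_one_left hL h1⟩
  refine ⟨c (r * dist y z), ⟨?_, ?_⟩, fun x => ?_⟩
  · have := hc.2.2 0 ⟨le_rfl, hL⟩ _ hs
    rw [hc.1] at this
    rw [this, zero_sub, abs_neg, abs_of_nonneg hs.1]
  · have := hc.2.2 _ hs _ ⟨hL, le_rfl⟩
    rw [hc.2.1] at this
    rw [this, abs_sub_comm, abs_of_nonneg (by linarith [hs.2])]
    ring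
  · obtain ⟨e, he⟩ := hX.1 y x
    obtain ⟨y', z', x', h2, h3, h4⟩ := exists_comparison_triangle y z x
    have key := hX.2 y z x c e hc he y' z' x' h2 h3 h4 _ hs (dist y x) ⟨dist_nonneg, le_rfl⟩
      (AffineMap.lineMap y' z' r) (by
        rw [segment_eq_image_lineMap]; exact ⟨r, ⟨h0, h1⟩, rfl⟩) x' (right_mem_segment _ _ _)
      (by rw [dist_left_lineMap, h2, Real.norm_eq_abs, abs_of_nonneg h0]) h3
    rw [he.2.1, dist_comm, dist_comm _ x'] at key
    calc dist x _ ^ 2 ≤ dist x' (AffineMap.lineMap y' z' r) ^ 2 := by gcongr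
      _ = _ := by
        rw [dist_sq_lineMap, dist_comm x' y', dist_comm x' z', h2, h3, h4, dist_comm y x,
          dist_comm z x]

lemma IsCAT0.exists_dividesAt (hX : IsCAT0 X) {r : ℝ} (h0 : 0 ≤ r) (h1 : r ≤ 1) (y z : X) :
    ∃ w, DividesAt r y z w :=
  let ⟨w, hw, _⟩ := hX.exists_dividesAt_forall_dist_sq_le h0 h1 y z
  ⟨w, hw⟩

/-- The Bruhat-Tits inequality. -/
lemma IsCAT0.dist_sq_le (hX : IsCAT0 X) {r : ℝ} (h0 : 0 ≤ r) (h1 : r ≤ 1) {y z w : X}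
    (hw : DividesAt r y z w) (x : X) :
    dist x w ^ 2 ≤ (1 - r) * dist x y ^ 2 + r * dist x z ^ 2 - r * (1 - r) * dist y z ^ 2 := by
  obtain ⟨m, -, hm⟩ := hX.exists_dividesAt_forall_dist_sq_le h0 h1 y z
  -- Testing the inequality at `w` itself makes its right side vanish, so `w` equals the constructed
  -- point `m`.
  have h := hm w
  rw [dist_comm w y, hw.1, hw.2] at h
  have h' : dist w m ^ 2 ≤ 0 := by nlinarith
  have : w = m := dist_eq_zero.1 (pow_eq_zero_iff two_ne_zero |>.1 (le_antisymm h' (sq_nonneg _)))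
  rw [this]
  exact hm x

/-- The quadrilateral (Cauchy-Schwarz) inequality. -/
lemma IsCAT0.quadrilateral (hX : IsCAT0 X) (x₁ x₂ x₃ x₄ : X) :
    dist x₁ x₃ ^ 2 + dist x₂ x₄ ^ 2 ≤
      dist x₁ x₄ ^ 2 + dist x₂ x₃ ^ 2 + 2 * (dist x₁ x₂ * dist x₃ x₄) := by
  rcases (dist_nonneg (x := x₁) (y := x₂)).eq_or_lt with hp | hp
  · rw [← dist_eq_zero.1 hp.symm]; simp; linarith
  rcases (dist_nonneg (x := x₃) (y := x₄)).eq_or_lt with hq | hq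
  · rw [← dist_eq_zero.1 hq.symm]; simp
  set p := dist x₁ x₂
  set q := dist x₃ x₄
  have hpq : 0 < p + q := by positivity
  have hr0 : 0 ≤ p / (p + q) := by positivity
  -- The detour from `x₁` to `x₃` passes through the point of `[x₂, x₄]` dividing it in the ratio `p
  -- : q`; the weighted bound `hs` on `(u + v) ^ 2` then produces the cross term `2 * p * q`.
  have hr1 : p / (p + q) ≤ 1 := by rw [div_le_one hpq]; linarith
  obtain ⟨w, hw⟩ := hX.exists_dividesAt hr0 hr1 x₂ x₄
  have e1 := hX.dist_sq_le hr0 hr1 hw x₁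
  have e2 := hX.dist_sq_le hr0 hr1 hw x₃
  have et : dist x₁ x₃ ≤ dist x₁ w + dist x₃ w := by
    rw [dist_comm x₃ w]; exact dist_triangle _ _ _
  rw [dist_comm x₃ x₂] at e2
  change dist x₁ w ^ 2 ≤ (1 - p / (p + q)) * p ^ 2 + _ - _ at e1
  change dist x₃ w ^ 2 ≤ _ + p / (p + q) * q ^ 2 - _ at e2
  set u := dist x₁ w
  set v := dist x₃ w
  have hu : 0 ≤ u := dist_nonneg
  have hv : 0 ≤ v := dist_nonneg
  have hs : dist x₁ x₃ ^ 2 ≤ (p + q) / p * u ^ 2 + (p + q) / q * v ^ 2 := by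
    have : (p + q) / p * u ^ 2 + (p + q) / q * v ^ 2 - (u + v) ^ 2 = (q * u - p * v) ^ 2 / (p * q) := by
      field_simp; ring
    have h2 : 0 ≤ (q * u - p * v) ^ 2 / (p * q) := by positivity
    have h3 : dist x₁ x₃ ^ 2 ≤ (u + v) ^ 2 := by gcongr
    linarith
  have e1' := mul_le_mul_of_nonneg_left e1 (by positivity : 0 ≤ (p + q) / p)
  have e2' := mul_le_mul_of_nonneg_left e2 (by positivity : 0 ≤ (p + q) / q)
  have i1 : (p + q) / p * ((1 - p / (p + q)) * p ^ 2 + p / (p + q) * dist x₁ x₄ ^ 2 -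
      p / (p + q) * (1 - p / (p + q)) * dist x₂ x₄ ^ 2) =
      p * q + dist x₁ x₄ ^ 2 - q / (p + q) * dist x₂ x₄ ^ 2 := by field_simp; ring
  have i2 : (p + q) / q * ((1 - p / (p + q)) * dist x₂ x₃ ^ 2 + p / (p + q) * q ^ 2 -
      p / (p + q) * (1 - p / (p + q)) * dist x₂ x₄ ^ 2) =
      p * q + dist x₂ x₃ ^ 2 - p / (p + q) * dist x₂ x₄ ^ 2 := by field_simp; ring
  have i3 : q / (p + q) * dist x₂ x₄ ^ 2 + p / (p + q) * dist x₂ x₄ ^ 2 = dist x₂ x₄ ^ 2 := by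
    field_simp; ring
  rw [i1] at e1'
  rw [i2] at e2'
  linarith

lemma IsCAT0.dist_sq_le_of_dividesAt (hX : IsCAT0 X) {r : ℝ} (h0 : 0 ≤ r) (h1 : r ≤ 1)
    {x y w x' y' w' : X} (hw : DividesAt r x y w) (hw' : DividesAt r x' y' w')
    (hL : dist x' y' = dist x y) :
    dist w w' ^ 2 ≤ (1 - r) ^ 2 * dist x x' ^ 2 + r ^ 2 * dist y y' ^ 2
      + r * (1 - r) * (dist x y' ^ 2 + dist y x' ^ 2) - 2 * (r * (1 - r)) * dist x y ^ 2 := by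
  have e := hX.dist_sq_le h0 h1 hw w'
  have e1 := hX.dist_sq_le h0 h1 hw' x
  have e2 := hX.dist_sq_le h0 h1 hw' y
  rw [dist_comm w' w, dist_comm w' x, dist_comm w' y] at e
  rw [hL] at e1 e2
  have f1 := mul_le_mul_of_nonneg_left e1 (by linarith : 0 ≤ 1 - r)
  have f2 := mul_le_mul_of_nonneg_left e2 h0
  nlinarith

/-- Convexity of the squared distance between two geodesic segments of equal length. -/
lemma IsCAT0.dist_sq_convex (hX : IsCAT0 X) {r : ℝ} (h0 : 0 ≤ r) (h1 : r ≤ 1)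
    {x y w x' y' w' : X} (hw : DividesAt r x y w) (hw' : DividesAt r x' y' w')
    (hL : dist x' y' = dist x y) :
    dist w w' ^ 2 ≤ (1 - r) * dist x x' ^ 2 + r * dist y y' ^ 2 := by
  have e := hX.dist_sq_le_of_dividesAt h0 h1 hw hw' hL
  have q := hX.quadrilateral x y y' x'
  rw [dist_comm y' x', hL] at q
  have := mul_le_mul_of_nonneg_left q (by nlinarith : 0 ≤ r * (1 - r))
  nlinarith

/-! ### Projection to closed convex sets. -/

/-- A set containing all points of the geodesic segments between its points. -/
def IsGeodesicallyConvex (C : Set X) : Prop :=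
  ∀ x ∈ C, ∀ y ∈ C, ∀ r : ℝ, 0 ≤ r → r ≤ 1 → ∀ w, DividesAt r x y w → w ∈ C

/-- `q` is a point of `C` nearest to `x`. -/
def IsNearestPoint (C : Set X) (x q : X) : Prop :=
  q ∈ C ∧ ∀ q' ∈ C, dist x q ≤ dist x q'

lemma IsCAT0.exists_isNearestPoint [CompleteSpace X] (hX : IsCAT0 X) {C : Set X}
    (hC : IsGeodesicallyConvex C) (hcl : IsClosed C) (hne : C.Nonempty) (x : X) :
    ∃ q, IsNearestPoint C x q := by
  set D := Metric.infDist x C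
  have hD : 0 ≤ D := Metric.infDist_nonneg
  have hDle : ∀ q ∈ C, D ≤ dist x q := fun q hq => Metric.infDist_le_dist_of_mem hq
  have hex : ∀ n : ℕ, ∃ q ∈ C, dist x q < D + 1 / ((n : ℝ) + 1) := fun n =>
    (Metric.infDist_lt_iff hne).1 (by
      have : 0 < 1 / ((n : ℝ) + 1) := by positivity
      linarith)
  choose q hqC hq using hex
  have hlim : Filter.Tendsto (fun n : ℕ => D + 1 / ((n : ℝ) + 1)) Filter.atTop (nhds D) := by
    simpa using tendsto_one_div_add_atTop_nhds_zero_nat.const_add D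
  have hcau : CauchySeq q := by
    -- The midpoint of `q n` and `q m` lies in `C`, hence at distance at least `D` from `x`;
    -- Bruhat-Tits turns this into a bound on `dist (q n) (q m)`.
    refine cauchySeq_of_le_tendsto_0
      (fun n : ℕ => Real.sqrt (4 * ((D + 1 / ((n : ℝ) + 1)) ^ 2 - D ^ 2))) ?_ ?_
    · intro n m N hn hm
      apply Real.le_sqrt_of_sq_le
      obtain ⟨w, hw⟩ := hX.exists_dividesAt (r := 1 / 2) (by norm_num) (by norm_num) (q n) (q m)
      have e := hX.dist_sq_le (by norm_num) (by norm_num) hw x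
      have hwC := hC _ (hqC n) _ (hqC m) _ (by norm_num) (by norm_num) w hw
      have e0 : D ^ 2 ≤ dist x w ^ 2 := by gcongr; exact hDle w hwC
      have hb : ∀ k, N ≤ k → dist x (q k) ^ 2 ≤ (D + 1 / ((N : ℝ) + 1)) ^ 2 := fun k hk => by
        have : 1 / ((k : ℝ) + 1) ≤ 1 / ((N : ℝ) + 1) := by gcongr
        have := hq k
        gcongr
        linarith
      have := hb n hn
      have := hb m hm
      linarith
    · have := (((hlim.pow 2).sub_const (D ^ 2)).const_mul 4).sqrt
      simpa using this
  obtain ⟨p, hp⟩ := cauchySeq_tendsto_of_complete hcau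
  refine ⟨p, hcl.mem_of_tendsto hp (Filter.Eventually.of_forall hqC), fun q' hq' => ?_⟩
  refine le_trans ?_ (hDle q' hq')
  exact le_of_tendsto_of_tendsto' (tendsto_const_nhds.dist hp) hlim fun n => (hq n).le

/-- The angle at the foot `p` is at least a right angle: moving a fraction `r` from `p` towards `q`
does not approach `x`; divide Bruhat-Tits by `r` and let `r` be small. -/
lemma IsCAT0.dist_sq_add_le_of_isNearestPoint (hX : IsCAT0 X) {C : Set X}
    (hC : IsGeodesicallyConvex C) {x p q : X} (hp : IsNearestPoint C x p) (hq : q ∈ C) :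
    dist x p ^ 2 + dist p q ^ 2 ≤ dist x q ^ 2 := by
  refine le_of_forall_pos_lt_add fun ε hε => ?_
  set A := dist p q ^ 2
  have hA : 0 ≤ A := sq_nonneg _
  set r := ε / (A + 2 * ε)
  have hr0 : 0 < r := by positivity
  have hr1 : r ≤ 1 := by rw [div_le_one (by positivity)]; linarith
  have hrA : r * A < ε := by
    rw [div_mul_eq_mul_div, div_lt_iff₀ (by positivity)]; nlinarith
  obtain ⟨w, hw⟩ := hX.exists_dividesAt hr0.le hr1 p q
  have e := hX.dist_sq_le hr0.le hr1 hw x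
  have h : dist x p ^ 2 ≤ dist x w ^ 2 := by
    gcongr; exact hp.2 w (hC _ hp.1 _ hq _ hr0.le hr1 w hw)
  have : r * (dist x p ^ 2 + (1 - r) * A) ≤ r * dist x q ^ 2 := by
    change _ ≤ _ + _ - r * (1 - r) * A at e
    linarith
  have := le_of_mul_le_mul_left this hr0
  linarith

/-- Adding the obtuse-angle inequalities at `p` and `q` to the quadrilateral inequality gives `dist
p q ^ 2 ≤ dist x y * dist p q`. -/
lemma IsCAT0.dist_le_of_isNearestPoint (hX : IsCAT0 X) {C : Set X}
    (hC : IsGeodesicallyConvex C) {x y p q : X} (hp : IsNearestPoint C x p)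
    (hq : IsNearestPoint C y q) : dist p q ≤ dist x y := by
  have e1 := hX.dist_sq_add_le_of_isNearestPoint hC hp hq.1
  have e2 := hX.dist_sq_add_le_of_isNearestPoint hC hq hp.1
  have e3 := hX.quadrilateral x y q p
  rw [dist_comm q p] at e2 e3
  by_contra! h
  have : 0 ≤ dist x y := dist_nonneg
  nlinarith

end CAT0

/-! ### Translation lengths and minimal sets. -/

section Axes

variable {X : Type*} [MetricSpace X]

lemma translationLength_nonneg (γ : X ≃ᵢ X) : 0 ≤ translationLength γ :=
  Real.iInf_nonneg fun _ => dist_nonneg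

lemma translationLength_le (γ : X ≃ᵢ X) (x : X) : translationLength γ ≤ dist x (γ x) :=
  ciInf_le ⟨0, by rintro _ ⟨y, rfl⟩; exact dist_nonneg⟩ x

lemma Commute.apply_apply {γ g : X ≃ᵢ X} (h : Commute g γ) (x : X) : g (γ x) = γ (g x) :=
  DFunLike.congr_fun h.eq x

lemma mem_minSet_of_le {γ : X ≃ᵢ X} {x : X} (h : dist x (γ x) ≤ translationLength γ) :
    x ∈ minSet γ :=
  le_antisymm h (translationLength_le γ x)

lemma apply_mem_minSet {γ g : X ≃ᵢ X} (h : Commute g γ) {x : X} (hx : x ∈ minSet γ) :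
    g x ∈ minSet γ := by
  change dist (g x) (γ (g x)) = _
  rw [← h.apply_apply, g.isometry.dist_eq]
  exact hx

lemma isClosed_minSet (γ : X ≃ᵢ X) : IsClosed (minSet γ) :=
  isClosed_eq (continuous_id.dist γ.continuous) continuous_const

lemma DividesAt.map {r : ℝ} {x y w : X} (h : DividesAt r x y w) (γ : X ≃ᵢ X) :
    DividesAt r (γ x) (γ y) (γ w) := by
  simpa only [DividesAt, γ.isometry.dist_eq] using h

lemma IsCAT0.isGeodesicallyConvex_minSet (hX : IsCAT0 X) (γ : X ≃ᵢ X) :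
    IsGeodesicallyConvex (minSet γ) := by
  intro x hx y hy r h0 h1 w hw
  have e := hX.dist_sq_convex h0 h1 hw (hw.map γ) (γ.isometry.dist_eq _ _)
  rw [show dist x (γ x) = _ from hx, show dist y (γ y) = _ from hy] at e
  refine mem_minSet_of_le (abs_le_of_sq_le_sq' ?_ (translationLength_nonneg γ)).2
  linarith

/-- The midpoint `m` of `y` and `γ y` is sent to the midpoint of `γ y` and `γ (γ y)`, and a midline
is at most half of the third side. -/
lemma IsCAT0.two_mul_le_dist (hX : IsCAT0 X) {γ : X ≃ᵢ X} {a : ℝ} (ha : 0 ≤ a)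
    (h : ∀ y, a ≤ dist y (γ y)) (y : X) : 2 * a ≤ dist y (γ (γ y)) := by
  obtain ⟨m, hm⟩ := hX.exists_dividesAt (r := 1 / 2) (by norm_num) (by norm_num) y (γ y)
  have e := hX.dist_sq_le_of_dividesAt (by norm_num) (by norm_num) hm (hm.map γ)
    (γ.isometry.dist_eq _ _)
  rw [γ.isometry.dist_eq, dist_self] at e
  have : a ^ 2 ≤ dist m (γ m) ^ 2 := by gcongr; exact h m
  refine (abs_le_of_sq_le_sq' (by linarith) dist_nonneg).2

lemma IsCAT0.two_pow_mul_le_dist (hX : IsCAT0 X) {γ : X ≃ᵢ X} {a : ℝ} (ha : 0 ≤ a)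
    (h : ∀ y, a ≤ dist y (γ y)) (n : ℕ) : ∀ y, 2 ^ n * a ≤ dist y ((γ ^ 2 ^ n) y) := by
  induction n with
  | zero => simpa using h
  | succ n ih =>
    intro y
    have := hX.two_mul_le_dist (by positivity) ih y
    rw [pow_succ 2 n, pow_succ 2 n, pow_mul, pow_two (γ ^ 2 ^ n), IsometryEquiv.mul_apply]
    linarith

lemma dist_pow_le (γ : X ≃ᵢ X) (x : X) (n : ℕ) : dist x ((γ ^ n) x) ≤ n * dist x (γ x) := by
  induction n with
  | zero => simp
  | succ n ih =>
    have h := dist_triangle x ((γ ^ n) x) ((γ ^ (n + 1)) x)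
    rw [pow_succ, IsometryEquiv.mul_apply, (γ ^ n).isometry.dist_eq] at h
    rw [pow_succ, IsometryEquiv.mul_apply]
    push_cast
    linarith

/-- Doubling gives the lower bound at the exponent `2 ^ n = n + k`; a shortfall at `n` could not be
recovered by the remaining `k` steps. -/
lemma IsCAT0.dist_pow (hX : IsCAT0 X) {γ : X ≃ᵢ X} {x : X} (hx : x ∈ minSet γ) (n : ℕ) :
    dist x ((γ ^ n) x) = n * translationLength γ := by
  have hx' : dist x (γ x) = translationLength γ := hx
  refine le_antisymm (hx' ▸ dist_pow_le γ x n) ?_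
  have h1 := hX.two_pow_mul_le_dist (translationLength_nonneg γ) (translationLength_le γ) n x
  have hn : n ≤ 2 ^ n := n.lt_two_pow_self.le
  obtain ⟨k, hk⟩ := Nat.exists_eq_add_of_le hn
  have h2 := dist_triangle x ((γ ^ n) x) ((γ ^ 2 ^ n) x)
  have h3 := dist_pow_le γ x k
  have hk' : (2 : ℝ) ^ n = n + k := by exact_mod_cast hk
  rw [hk', hk, pow_add, IsometryEquiv.mul_apply] at h1
  rw [hk, pow_add, IsometryEquiv.mul_apply, (γ ^ n).isometry.dist_eq] at h2
  rw [hx'] at h3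
  linarith

lemma IsCAT0.dist_zpow (hX : IsCAT0 X) {γ : X ≃ᵢ X} {x : X} (hx : x ∈ minSet γ) {m n : ℤ}
    (h : m ≤ n) : dist ((γ ^ m) x) ((γ ^ n) x) = (n - m) * translationLength γ := by
  obtain ⟨k, rfl⟩ := Int.le.dest h
  rw [zpow_add, zpow_natCast, IsometryEquiv.mul_apply, (γ ^ m).isometry.dist_eq, hX.dist_pow hx]
  push_cast
  ring

/-! ### Axes and their parallelism. -/

/-- An axis of `γ`, parametrised by arc length. -/
def IsAxis (γ : X ≃ᵢ X) (c : ℝ → X) : Prop :=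
  Isometry c ∧ ∀ t, γ (c t) = c (t + translationLength γ)

/-- A 1-Lipschitz curve that is length-minimising between `-T` and `T` cannot lose length on any
subinterval. -/
lemma isometry_of_dist_le_of_dist_eq {c : ℝ → X} (h : ∀ s t, s ≤ t → dist (c s) (c t) ≤ t - s)
    (h' : ∀ t : ℝ, ∃ T, |t| ≤ T ∧ dist (c (-T)) (c T) = 2 * T) : Isometry c := by
  have key : ∀ s t, s ≤ t → dist (c s) (c t) = t - s := by
    intro s t hst
    refine le_antisymm (h s t hst) ?_
    obtain ⟨T, hT, hd⟩ := h' (max |s| |t|)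
    rw [abs_of_nonneg (le_max_of_le_left (abs_nonneg s))] at hT
    obtain ⟨hs, ht⟩ := max_le_iff.1 hT
    have h1 := h (-T) s (neg_le_of_abs_le hs)
    have h2 := h t T (le_of_abs_le ht)
    have h3 := dist_triangle4 (c (-T)) (c s) (c t) (c T)
    linarith
  refine Isometry.of_dist_eq fun s t => ?_
  rcases le_total s t with hst | hst
  · rw [key s t hst, Real.dist_eq, abs_sub_comm, abs_of_nonneg (by linarith)]
  · rw [dist_comm, key t s hst, Real.dist_eq, abs_of_nonneg (by linarith)]

/-- Through every point of `Min(γ)` passes an axis. -/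
lemma IsCAT0.exists_isAxis (hX : IsCAT0 X) {γ : X ≃ᵢ X} (ha : 0 < translationLength γ) {x : X}
    (hx : x ∈ minSet γ) : ∃ c, IsAxis γ c ∧ c 0 = x := by
  obtain ⟨e, he0, he1, he⟩ := hX.1 x (γ x)
  rw [show dist x (γ x) = _ from hx] at he1 he
  set a := translationLength γ with ha_def
  -- The geodesic from `x` to `γ x`, continued periodically by the powers of `γ`.
  let c : ℝ → X := fun t => (γ ^ ⌊t / a⌋) (e (t - ⌊t / a⌋ * a))
  have hmem : ∀ t, t - ⌊t / a⌋ * a ∈ Set.Icc 0 a := fun t => by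
    have h1 := (le_div_iff₀ ha).1 (Int.floor_le (t / a))
    have h2 := (div_lt_iff₀ ha).1 (Int.lt_floor_add_one (t / a))
    constructor <;> linarith
  have hcn : ∀ n : ℤ, c (n * a) = (γ ^ n) x := fun n => by
    simp only [c]
    rw [mul_div_cancel_right₀ _ ha.ne', Int.floor_intCast, sub_self, he0]
  have hz : (0 : ℝ) ∈ Set.Icc 0 a := ⟨le_rfl, ha.le⟩
  have haa : a ∈ Set.Icc 0 a := ⟨ha.le, le_rfl⟩
  refine ⟨c, ⟨isometry_of_dist_le_of_dist_eq ?_ ?_, fun t => ?_⟩, ?_⟩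
  · intro s t hst
    have hfl : ⌊s / a⌋ ≤ ⌊t / a⌋ := Int.floor_le_floor (by gcongr)
    simp only [c]
    rcases hfl.eq_or_lt with heq | hlt
    · rw [← heq, (γ ^ _).isometry.dist_eq, he _ (hmem s) _ (heq ▸ hmem t), abs_sub_comm,
        sub_sub_sub_cancel_right, abs_of_nonneg (by linarith)]
    · have h4 := dist_triangle4 (c s) ((γ ^ (⌊s / a⌋ + 1)) x) ((γ ^ ⌊t / a⌋) x) (c t)
      rw [hX.dist_zpow hx (by omega : ⌊s / a⌋ + 1 ≤ ⌊t / a⌋), zpow_add_one,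
        IsometryEquiv.mul_apply] at h4
      simp only [c] at h4
      rw [(γ ^ ⌊s / a⌋).isometry.dist_eq, (γ ^ ⌊t / a⌋).isometry.dist_eq, ← he1, ← he0,
        he _ (hmem s) _ haa, he0, ← he0, he _ hz _ (hmem t), abs_sub_comm,
        abs_of_nonneg (by linarith [(hmem s).2]), zero_sub, abs_neg,
        abs_of_nonneg (hmem t).1, ← ha_def] at h4
      refine h4.trans (le_of_eq ?_)
      push_cast
      ring
  · intro t
    obtain ⟨n, hn⟩ := exists_nat_ge (|t| / a)
    refine ⟨(n : ℤ) * a, by simpa using (div_le_iff₀ ha).1 hn, ?_⟩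
    rw [← neg_mul, ← Int.cast_neg, hcn, hcn, hX.dist_zpow hx (by omega)]
    push_cast
    ring
  · simp only [c]
    rw [add_div, div_self ha.ne', Int.floor_add_one, add_comm ⌊t / a⌋, zpow_one_add,
      IsometryEquiv.mul_apply]
    congr 3
    push_cast
    ring
  · simpa using hcn 0

lemma Isometry.dividesAt {c : ℝ → X} (hc : Isometry c) {r : ℝ} (h0 : 0 ≤ r) (h1 : r ≤ 1)
    (s t : ℝ) : DividesAt r (c s) (c t) (c (s + r * (t - s))) := by
  constructor
  · rw [hc.dist_eq, hc.dist_eq, Real.dist_eq, Real.dist_eq, sub_add_cancel_left, abs_neg, abs_mul,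
      abs_of_nonneg h0, abs_sub_comm]
  · rw [hc.dist_eq, hc.dist_eq, Real.dist_eq, Real.dist_eq,
      show s + r * (t - s) - t = (1 - r) * (s - t) by ring, abs_mul,
      abs_of_nonneg (by linarith : 0 ≤ 1 - r)]

lemma IsAxis.apply_mem_minSet {γ : X ≃ᵢ X} {c : ℝ → X} (hc : IsAxis γ c) (t : ℝ) :
    c t ∈ minSet γ := by
  change dist _ _ = _
  rw [hc.2, hc.1.dist_eq, Real.dist_eq, sub_add_cancel_left, abs_neg,
    abs_of_nonneg (translationLength_nonneg γ)]

/-- Two axes of the same isometry stay at constant distance. -/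
lemma IsCAT0.dist_axis_add (hX : IsCAT0 X) {γ : X ≃ᵢ X} (ha : 0 < translationLength γ)
    {c c' : ℝ → X} (hc : IsAxis γ c) (hc' : IsAxis γ c') (s t u : ℝ) :
    dist (c (s + u)) (c' (t + u)) = dist (c s) (c' t) := by
  set a := translationLength γ with ha_def
  have step : ∀ s t, dist (c (s + a)) (c' (t + a)) = dist (c s) (c' t) := fun s t => by
    rw [← hc.2, ← hc'.2, γ.isometry.dist_eq]
  have hle : ∀ s t u, 0 ≤ u → u ≤ a → dist (c (s + u)) (c' (t + u)) ≤ dist (c s) (c' t) := by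
    intro s t u h0 h1
    have hr0 : 0 ≤ u / a := by positivity
    have hr1 : u / a ≤ 1 := (div_le_one ha).2 h1
    have e := hX.dist_sq_convex hr0 hr1 (hc.1.dividesAt hr0 hr1 s (s + a))
      (hc'.1.dividesAt hr0 hr1 t (t + a)) (by
        rw [hc.1.dist_eq, hc'.1.dist_eq]; simp)
    rw [step, add_sub_cancel_left, add_sub_cancel_left, div_mul_cancel₀ _ ha.ne'] at e
    exact (abs_le_of_sq_le_sq' (by linarith) dist_nonneg).2
  -- After a full period the distance returns to its initial value, so the inequality `hle` is an
  -- equality.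
  have heq : ∀ s t u, 0 ≤ u → u ≤ a → dist (c (s + u)) (c' (t + u)) = dist (c s) (c' t) := by
    intro s t u h0 h1
    refine le_antisymm (hle s t u h0 h1) ?_
    have := hle (s + u) (t + u) (a - u) (by linarith) (by linarith)
    rwa [add_assoc, add_assoc, add_sub_cancel, step] at this
  have hn : ∀ n : ℕ, ∀ s t u, 0 ≤ u → u ≤ n * a →
      dist (c (s + u)) (c' (t + u)) = dist (c s) (c' t) := by
    intro n
    induction n with
    | zero =>
      intro s t u h0 h1
      have : u = 0 := le_antisymm (by simpa using h1) h0
      simp [this]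
    | succ n ih =>
      intro s t u h0 h1
      rcases le_total u a with h | h
      · exact heq s t u h0 h
      · push_cast at h1
        have := ih s t (u - a) (by linarith) (by linarith)
        rw [← this, ← step (s + (u - a)), add_assoc, add_assoc, sub_add_cancel]
  have hpos : ∀ s t u, 0 ≤ u → dist (c (s + u)) (c' (t + u)) = dist (c s) (c' t) := by
    intro s t u h0
    obtain ⟨n, hn'⟩ := exists_nat_ge (u / a)
    exact hn n s t u h0 ((div_le_iff₀ ha).1 hn')
  rcases le_total 0 u with h | h
  · exact hpos s t u h
  · have := hpos (s + u) (t + u) (-u) (by linarith)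
    rw [add_neg_cancel_right, add_neg_cancel_right] at this
    exact this.symm

/-! ### The axial coordinate. -/

/-- Twice the difference of the coordinates of `x` and `y` along the axes of `γ`, with the sign
chosen such that `γ`-translates of `y` have larger values. -/
noncomputable def axialShift (γ : X ≃ᵢ X) (x y : X) : ℝ :=
  (dist x (γ y) ^ 2 - dist x y ^ 2 - translationLength γ ^ 2) / translationLength γ

/-- The flat strip theorem for two axes of the same isometry, in coordinates. -/
lemma IsCAT0.dist_sq_axis (hX : IsCAT0 X) {γ : X ≃ᵢ X} (ha : 0 < translationLength γ)
    {c c' : ℝ → X} (hc : IsAxis γ c) (hc' : IsAxis γ c') (s t : ℝ) :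
    dist (c s) (c' t) ^ 2 =
      (t - s) ^ 2 + axialShift γ (c 0) (c' 0) * (t - s) + dist (c 0) (c' 0) ^ 2 := by
  have hst : ∀ s t, dist (c s) (c' t) = dist (c 0) (c' (t - s)) := fun s t => by
    simpa using hX.dist_axis_add ha hc hc' 0 (t - s) s
  -- The quadrilateral and Bruhat-Tits inequalities bound the second difference from opposite sides.
  -- Subtracting `t ^ 2` and the constant term leaves a continuous additive `G`, hence a linear one;
  -- one period determines its slope.
  have hsecond : ∀ t h : ℝ, dist (c 0) (c' (t + h)) ^ 2 + dist (c 0) (c' (t - h)) ^ 2 =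
      2 * dist (c 0) (c' t) ^ 2 + 2 * h ^ 2 := by
    intro t h
    apply le_antisymm
    · have q := hX.quadrilateral (c 0) (c h) (c' (t + h)) (c' t)
      rw [hst h t, hst h (t + h), add_sub_cancel_right, hc.1.dist_eq, hc'.1.dist_eq,
        Real.dist_eq, Real.dist_eq, add_sub_cancel_left, zero_sub, abs_neg, abs_mul_abs_self] at q
      linarith
    · have q := hX.dist_sq_le (r := 1 / 2) (by norm_num) (by norm_num)
        (hc'.1.dividesAt (by norm_num) (by norm_num) (t - h) (t + h)) (c 0)
      rw [show t - h + 1 / 2 * (t + h - (t - h)) = t by ring, hc'.1.dist_eq, Real.dist_eq,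
        sq_abs] at q
      linarith
  let G : ℝ → ℝ := fun t => dist (c 0) (c' t) ^ 2 - t ^ 2 - dist (c 0) (c' 0) ^ 2
  have hG : ∀ u v, G (u + v) = G u + G v := by
    have h1 : ∀ t h, G (t + h) + G (t - h) = 2 * G t := fun t h => by
      have := hsecond t h
      simp only [G]
      linarith
    have h0 : G 0 = 0 := by simp [G]
    intro u v
    have e1 := h1 ((u + v) / 2) ((u + v) / 2)
    have e2 := h1 ((u + v) / 2) ((u - v) / 2)
    rw [sub_self, h0, add_halves] at e1
    rw [show (u + v) / 2 + (u - v) / 2 = u by ring, show (u + v) / 2 - (u - v) / 2 = v by ring] at e2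
    linarith
  have hGc : Continuous G := by
    have := hc'.1.continuous
    fun_prop
  have hlin : ∀ t, G t = t * G 1 := fun t => by
    have := ((AddMonoidHom.mk' G hG).toRealLinearMap hGc).map_smul t 1
    rw [smul_eq_mul, mul_one, smul_eq_mul] at this
    exact this
  have hk : G 1 = axialShift γ (c 0) (c' 0) := by
    have h1 := hlin (translationLength γ)
    rw [axialShift, hc'.2, zero_add, eq_div_iff ha.ne']
    simp only [G] at h1 ⊢
    linarith
  have := hlin (t - s)
  rw [hk] at this
  rw [hst]
  simp only [G] at this
  linarith

lemma IsCAT0.axialShift_neg (hX : IsCAT0 X) {γ : X ≃ᵢ X} (ha : 0 < translationLength γ)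
    {x y : X} (hx : x ∈ minSet γ) (hy : y ∈ minSet γ) :
    axialShift γ y x = - axialShift γ x y := by
  obtain ⟨c, hc, rfl⟩ := hX.exists_isAxis ha hx
  obtain ⟨c', hc', rfl⟩ := hX.exists_isAxis ha hy
  have h1 := hX.dist_sq_axis ha hc hc' 1 0
  have h2 := hX.dist_sq_axis ha hc' hc 0 1
  rw [dist_comm, dist_comm (c 0)] at h1
  linarith

/-- For large `s`, `√(s ^ 2 + k * s + D) = s + k / 2 + o(1)`, so the triangle inequality `r ≤ u + v`
compares the linear coefficients. -/
lemma coeff_le_add_of_sq_eq {k k₁ k₂ D D₁ D₂ : ℝ} (hD : 0 ≤ D)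
    (h : ∀ T : ℝ, 0 < T → ∃ r u v : ℝ, 0 ≤ r ∧ r ≤ u + v ∧ r ^ 2 = (2 * T) ^ 2 + k * (2 * T) + D ∧
      u ^ 2 = T ^ 2 + k₁ * T + D₁ ∧ v ^ 2 = T ^ 2 + k₂ * T + D₂) : k ≤ k₁ + k₂ := by
  by_contra! hlt
  set q := (k₁ + k₂) / 2
  set E := (D₁ + D₂) / 2
  set B := q ^ 2 + 4 * |E| + 2 * |q * E| + E ^ 2
  have hB : 0 ≤ B := by positivity
  set δ := k - (k₁ + k₂) with hδ_def
  have hδ : 0 < δ := by linarith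
  -- `B` dominates all bounded terms after squaring, and this `T` makes the excess `2 * T * δ`
  -- larger than `B`.
  set T := 1 + B / δ with hT
  have hT1 : 1 ≤ T := by rw [hT]; linarith [div_nonneg hB hδ.le]
  have hT0 : 0 < T := by linarith
  obtain ⟨r, u, v, hr, hruv, hr2, hu2, hv2⟩ := h T hT0
  set z := E / T with hz
  have hzT : z * T = E := by rw [hz]; field_simp
  have hle : r ≤ 2 * T + q + z := by
    have h1 : 2 * T * u ≤ u ^ 2 + T ^ 2 := by nlinarith [sq_nonneg (u - T)]
    have h2 : 2 * T * v ≤ v ^ 2 + T ^ 2 := by nlinarith [sq_nonneg (v - T)]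
    have h3 : (2 * T) * r ≤ (2 * T) * (2 * T + q + z) := by
      have : (2 * T) * z = D₁ + D₂ := by rw [mul_assoc, mul_comm T z, hzT]; simp only [E]; ring
      have : (2 * T) * q = T * k₁ + T * k₂ := by simp only [q]; ring
      nlinarith
    exact le_of_mul_le_mul_left h3 (by linarith)
  have hsq : r ^ 2 ≤ (2 * T + q + z) ^ 2 := by gcongr
  have hzE : |z| ≤ |E| := by
    rw [hz, abs_div, abs_of_pos hT0]
    exact div_le_self (abs_nonneg _) hT1
  have hz2 : z ^ 2 ≤ E ^ 2 := sq_le_sq.2 hzE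
  have hqz : q * z ≤ |q * E| := by
    rw [abs_mul]
    exact (le_abs_self _).trans (by rw [abs_mul]; gcongr)
  have hk : k = δ + 2 * q := by simp only [q]; linarith
  have hTδ : T * δ = δ + B := by rw [hT]; field_simp
  have hEa := le_abs_self E
  rw [hr2, hk] at hsq
  have e : (2 * T + q + z) ^ 2 = 4 * T ^ 2 + 4 * q * T + 4 * (z * T) + q ^ 2 + 2 * (q * z) + z ^ 2 := by
    ring
  rw [e, hzT] at hsq
  simp only [B] at hTδ hB
  nlinarith

/-- The cocycle identity for `axialShift`. -/
lemma IsCAT0.axialShift_add (hX : IsCAT0 X) {γ : X ≃ᵢ X} (ha : 0 < translationLength γ)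
    {x y z : X} (hx : x ∈ minSet γ) (hy : y ∈ minSet γ) (hz : z ∈ minSet γ) :
    axialShift γ x z = axialShift γ x y + axialShift γ y z := by
  have key : ∀ x ∈ minSet γ, ∀ y ∈ minSet γ, ∀ z ∈ minSet γ,
      axialShift γ x z ≤ axialShift γ x y + axialShift γ y z := by
    intro x hx y hy z hz
    obtain ⟨c, hc, rfl⟩ := hX.exists_isAxis ha hx
    obtain ⟨c', hc', rfl⟩ := hX.exists_isAxis ha hy
    obtain ⟨c'', hc'', rfl⟩ := hX.exists_isAxis ha hz
    refine coeff_le_add_of_sq_eq (sq_nonneg (dist (c 0) (c'' 0)))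
      (D₁ := dist (c 0) (c' 0) ^ 2) (D₂ := dist (c' 0) (c'' 0) ^ 2) fun T _ =>
      ⟨dist (c 0) (c'' (2 * T)), dist (c 0) (c' T), dist (c' T) (c'' (2 * T)), dist_nonneg,
        dist_triangle _ _ _, ?_, ?_, ?_⟩
    · simpa using hX.dist_sq_axis ha hc hc'' 0 (2 * T)
    · simpa using hX.dist_sq_axis ha hc hc' 0 T
    · have := hX.dist_sq_axis ha hc' hc'' T (2 * T)
      rwa [show 2 * T - T = T by ring] at this
  refine le_antisymm (key x hx y hy z hz) ?_
  -- Antisymmetry converts the inequality for the reversed triple into the opposite one.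
  have := key z hz y hy x hx
  rw [hX.axialShift_neg ha hx hz, hX.axialShift_neg ha hx hy, hX.axialShift_neg ha hy hz] at this
  linarith

lemma axialShift_apply_apply {γ g : X ≃ᵢ X} (h : Commute g γ) (x y : X) :
    axialShift γ (g x) (g y) = axialShift γ x y := by
  rw [axialShift, axialShift, ← h.apply_apply, g.isometry.dist_eq, g.isometry.dist_eq]

end Axes

/-! ### Common minimal points and flats. -/

section Flats

variable {X : Type*} [MetricSpace X]

lemma isGeodesicallyConvex_biInter {ι : Type*} {s : Finset ι} {C : ι → Set X}
    (h : ∀ i, IsGeodesicallyConvex (C i)) : IsGeodesicallyConvex (⋂ i ∈ s, C i) := by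
  intro x hx y hy r h0 h1 w hw
  rw [Set.mem_iInter₂] at *
  exact fun i hi => h i x (hx i hi) y (hy i hi) r h0 h1 w hw

/-- Finitely many commuting semisimple isometries attain their translation lengths
simultaneously. -/
lemma IsCAT0.nonempty_biInter_minSet [CompleteSpace X] [Nonempty X] (hX : IsCAT0 X) {ι : Type*}
    {γ : ι → X ≃ᵢ X} (hcomm : ∀ i j, Commute (γ i) (γ j))
    (hs : ∀ i, IsSemisimpleIsometry (γ i)) (s : Finset ι) :
    (⋂ i ∈ s, minSet (γ i)).Nonempty := by
  classical
  induction s using Finset.induction_on with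
  | empty => simp
  | insert j s _ ih =>
    have hconv : IsGeodesicallyConvex (⋂ i ∈ s, minSet (γ i)) :=
      isGeodesicallyConvex_biInter fun i => hX.isGeodesicallyConvex_minSet (γ i)
    have hcl : IsClosed (⋂ i ∈ s, minSet (γ i)) :=
      isClosed_biInter fun i _ => isClosed_minSet (γ i)
    obtain ⟨x, hx⟩ := hs j
    obtain ⟨p, hp⟩ := hX.exists_isNearestPoint hconv hcl ih x
    -- `γ j` preserves the intersection, so it commutes with projection; as projection is
    -- 1-Lipschitz, `γ j` displaces `p` no more than `x`.
    have hp' : IsNearestPoint (⋂ i ∈ s, minSet (γ i)) (γ j x) (γ j p) := by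
      refine ⟨Set.mem_iInter₂.2 fun i hi =>
        apply_mem_minSet (hcomm j i) (Set.mem_iInter₂.1 hp.1 i hi), fun q hq => ?_⟩
      have hq' : (γ j)⁻¹ q ∈ ⋂ i ∈ s, minSet (γ i) := Set.mem_iInter₂.2 fun i hi =>
        apply_mem_minSet (hcomm j i).inv_left (Set.mem_iInter₂.1 hq i hi)
      have := hp.2 _ hq'
      rwa [← (γ j).isometry.dist_eq x ((γ j)⁻¹ q), IsometryEquiv.apply_inv_self,
        ← (γ j).isometry.dist_eq x p] at this
    have hle := hX.dist_le_of_isNearestPoint hconv hp hp'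
    rw [show dist x (γ j x) = _ from hx] at hle
    refine ⟨p, ?_⟩
    rw [Finset.set_biInter_insert]
    exact ⟨mem_minSet_of_le hle, hp.1⟩

/-- A group of isometries commuting with a hyperbolic isometry `γ` acts on the axial coordinate of
`γ` by a homomorphism to `ℝ`, hence trivially if there is no nontrivial such homomorphism. -/
lemma IsCAT0.axialShift_apply_eq_zero (hX : IsCAT0 X) {γ : X ≃ᵢ X} (ha : 0 < translationLength γ)
    {G : Type*} [Group G] (hG : ∀ φ : G →* Multiplicative ℝ, φ = 1) (ρ : G →* (X ≃ᵢ X))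
    (hcomm : ∀ g, Commute (ρ g) γ) {x : X} (hx : x ∈ minSet γ) (g : G) :
    axialShift γ x (ρ g x) = 0 := by
  let φ : G →* Multiplicative ℝ := MonoidHom.mk'
    (fun g => Multiplicative.ofAdd (axialShift γ x (ρ g x))) (fun g h => by
      rw [← ofAdd_add, map_mul, IsometryEquiv.mul_apply, hX.axialShift_add ha hx
        (apply_mem_minSet (hcomm g) hx)
        (apply_mem_minSet (hcomm g) (apply_mem_minSet (hcomm h) hx)),
        axialShift_apply_apply (hcomm g)])
  have : φ g = 1 := by rw [hG φ]; rfl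
  exact this

/-- If `g` commutes with `γ` and does not move the axial coordinate of `γ`, then the axes of `γ`
through `Min(g)` stay in `Min(g)` and are orthogonal to those of `g`. -/
lemma IsCAT0.axialShift_axis_eq_zero (hX : IsCAT0 X) {γ g : X ≃ᵢ X}
    (ha : 0 < translationLength γ) (hcomm : Commute g γ) {c : ℝ → X} (hc : IsAxis γ c)
    (h0 : c 0 ∈ minSet g) (hshift : axialShift γ (c 0) (g (c 0)) = 0) (t : ℝ) :
    c t ∈ minSet g ∧ axialShift g (c 0) (c t) = 0 := by
  have hgc : IsAxis γ (g ∘ c) :=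
    ⟨g.isometry.comp hc.1, fun t => by
      simp only [Function.comp]; rw [← hcomm.apply_apply, hc.2]⟩
  -- With zero shift, `dist (c s) (g (c t)) ^ 2 = (t - s) ^ 2 + translationLength g ^ 2`: equal
  -- parameters give membership in `minSet g`, and parameters `0`, `t` give orthogonality.
  have key := hX.dist_sq_axis ha hc hgc
  simp only [Function.comp, hshift, zero_mul, add_zero] at key
  rw [show dist (c 0) (g (c 0)) = _ from h0] at key
  constructor
  · refine mem_minSet_of_le (abs_le_of_sq_le_sq' ?_ (translationLength_nonneg g)).2
    rw [key]; simp
  · rw [axialShift, key, hc.1.dist_eq, Real.dist_eq, sq_abs]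
    simp

/-- Commuting hyperbolic isometries that do not move each other's axial coordinates span a flat. -/
lemma IsCAT0.containsFlat_of_axialShift_eq_zero (hX : IsCAT0 X) {n : ℕ} {γ : Fin n → X ≃ᵢ X}
    (ha : ∀ i, 0 < translationLength (γ i)) (hcomm : ∀ i j, Commute (γ i) (γ j))
    (hshift : ∀ i j, i ≠ j → ∀ x ∈ minSet (γ i), axialShift (γ i) x (γ j x) = 0)
    {p : X} (hp : ∀ i, p ∈ minSet (γ i)) : ContainsFlat X n := by
  -- The `k`-flat uses the directions of the first `k` isometries. Vanishing of the remaining axial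
  -- coordinates makes the next axis direction orthogonal to it, so distances add by Pythagoras.
  have key : ∀ k ≤ n, ∃ f : EuclideanSpace ℝ (Fin k) → X, Isometry f ∧
      (∀ v i, f v ∈ minSet (γ i)) ∧ ∀ v (i : Fin n), k ≤ i → axialShift (γ i) p (f v) = 0 := by
    intro k
    induction k with
    | zero =>
      refine fun _ => ⟨fun _ => p, isometry_subsingleton, fun _ => hp, fun _ i _ => ?_⟩
      have h := hX.axialShift_add (ha i) (hp i) (hp i) (hp i)
      linarith
    | succ k ih =>
      intro hk
      obtain ⟨f, hf, hmem, hzero⟩ := ih (by omega)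
      let j : Fin n := ⟨k, hk⟩
      choose c hc hc0 using fun v => hX.exists_isAxis (ha j) (hmem v j)
      have hcj : ∀ v t i, i ≠ j →
          c v t ∈ minSet (γ i) ∧ axialShift (γ i) (f v) (c v t) = 0 := fun v t i hij => by
        rw [← hc0 v]
        refine hX.axialShift_axis_eq_zero (ha j) (hcomm i j) (hc v) ?_ ?_ t
        · rw [hc0]; exact hmem v i
        · rw [hc0]; exact hshift j i hij.symm _ (hmem v j)
      have hcmem : ∀ v t i, c v t ∈ minSet (γ i) := fun v t i => by
        rcases eq_or_ne i j with rfl | hij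
        · exact (hc v).apply_mem_minSet t
        · exact (hcj v t i hij).1
      let π : EuclideanSpace ℝ (Fin (k + 1)) → EuclideanSpace ℝ (Fin k) :=
        fun v => WithLp.toLp 2 fun i => v i.castSucc
      refine ⟨fun v => c (π v) (v (Fin.last k)), Isometry.of_dist_eq fun v w => ?_,
        fun v i => hcmem _ _ i, fun v i hi => ?_⟩
      · have hvw : axialShift (γ j) (f (π v)) (f (π w)) = 0 := by
          have h := hX.axialShift_add (ha j) (hp j) (hmem (π v) j) (hmem (π w) j)
          rw [hzero _ j le_rfl, hzero _ j le_rfl] at h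
          linarith
        have h := hX.dist_sq_axis (ha j) (hc (π v)) (hc (π w)) (v (Fin.last k)) (w (Fin.last k))
        rw [hc0, hc0, hvw, hf.dist_eq] at h
        refine (sq_eq_sq₀ dist_nonneg dist_nonneg).1 ?_
        rw [h, EuclideanSpace.dist_sq_eq, EuclideanSpace.dist_sq_eq, Fin.sum_univ_castSucc,
          Real.dist_eq (v (Fin.last k)), sq_abs]
        simp only [π]
        ring
      · have hij : i ≠ j := by
          rintro rfl
          simp [j] at hi
        rw [hX.axialShift_add (ha i) (hp i) (hmem (π v) i) (hcmem _ _ i), hzero _ i (by omega),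
          (hcj _ _ i hij).2, add_zero]
  obtain ⟨f, hf, -⟩ := key n le_rfl
  exact ⟨f, hf⟩

end Flats

/-! ### Conclusion for product actions. -/

theorem mainTheorem4 (d : ℕ) (K : Fin (d + 1) → Type*) [∀ i, Group (K i)]
    (hK : ∀ i, ∀ φ : K i →* Multiplicative ℝ, φ = 1)
    (X : Type*) [MetricSpace X] [CompleteSpace X] (hX : IsCAT0 X)
    (hflat : ¬ ContainsFlat X (d + 1)) :
    ¬ ∃ ρ : ((i : Fin (d + 1)) → K i) →* (X ≃ᵢ X),
        ∀ i, ∃ k : K i, IsHyperbolicIsometry (ρ (Pi.mulSingle i k)) := by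
  rintro ⟨ρ, hρ⟩
  choose k hk using hρ
  have : Nonempty X := ⟨(hk 0).1.some⟩
  have hne : ∀ i j, i ≠ j → ∀ (a : K i) (b : K j),
      Commute (ρ (Pi.mulSingle i a)) (ρ (Pi.mulSingle j b)) := fun i j hij a b =>
    (Pi.mulSingle_commute hij a b).map ρ
  have hcomm : ∀ i j, Commute (ρ (Pi.mulSingle i (k i))) (ρ (Pi.mulSingle j (k j))) := by
    intro i j
    rcases eq_or_ne i j with rfl | hij
    · exact Commute.refl _
    · exact hne i j hij _ _
  obtain ⟨p, hp⟩ := hX.nonempty_biInter_minSet hcomm (fun i => (hk i).1) Finset.univ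
  refine hflat (hX.containsFlat_of_axialShift_eq_zero (fun i => (hk i).2) hcomm
    (fun i j hij x hx => ?_) (p := p) fun i => Set.mem_iInter₂.1 hp i (Finset.mem_univ i))
  exact hX.axialShift_apply_eq_zero (hk i).2 (hK j) (ρ.comp (MonoidHom.mulSingle K j))
    (fun g => hne j i hij.symm g (k i)) hx (k j)
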